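/- Let $F$ be an algebraically closed field and let $m,k\ge 1$ be integers. Let $S=F[x_{i,j}^{(l)} : 1\le i,j\le m,\ 0\le l<k]$, let $X(t)$ be the generic $m\times m$ matrix with entries $\sum_{l=0}^{k-1}x_{i,j}^{(l)}t^l$, and let $d_0,\dots,d_{k-1}\in S$ be the coefficients of $t^0,\dots,t^{k-1}$ in $\det X(t)$ (equivalently, all coefficients of $\det X(t)$ computed modulo $t^k$). Let $\mathcal I^{m,m}_{m,k}=(d_0,\dots,d_{k-1})\subseteq S$ and let $\mathcal Z^{m,m}_{m,k}\subseteq F^{m^2k}$ be its zero set. Then $\mathcal I^{m,m}_{m,k}$ is a prime ideal of codimension (height) $k$. In particular it is the full vanishing ideal of $\mathcal Z^{m,m}_{m,k}$, so that the coordinate ring of $\mathcal Z^{m,m}_{m,k}$ is $S/\mathcal I^{m,m}_{m,k}$. This coordinate ring is a complete intersection, that is, it is isomorphic as an $F$-algebra to a quotient of a polynomial ring in finitely many variables over $F$ by an ideal generated by a regular sequence; hence it is Cohen--Macaulay, that is, it is Noetherian and the depth of each of its maximal ideals equals the height of that ideal. -/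

import Mathlib

noncomputable section

namespace TruncDet

/-- The variables `x_{i,j}^{(l)}`, with `1 ≤ i, j ≤ m` and `0 ≤ l < k` (rows and columns are
numbered from `0` here); the variable `x_{i,j}^{(l)}` is `(i, j, l)`. -/
abbrev Vars (m k : ℕ) : Type := Fin m × Fin m × Fin k

/-- The polynomial ring `S = F[x_{i,j}^{(l)}]` in `m²k` variables. -/
abbrev PolyRing (F : Type*) [Field F] (m k : ℕ) : Type _ := MvPolynomial (Vars m k) F

/-- The generic matrix `X(t)`, with entries `∑_{l < k} x_{i,j}^{(l)} t^l`. The entries are written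
in `S[t]`, as the representatives of degree `< k` of the entries in `S[t]/(t^k)`. -/
def genericMatrix (F : Type*) [Field F] (m k : ℕ) :
    Matrix (Fin m) (Fin m) (Polynomial (PolyRing F m k)) :=
  Matrix.of fun i j =>
    ∑ l : Fin k, Polynomial.C (MvPolynomial.X (i, j, l)) * Polynomial.X ^ (l : ℕ)

/-- The coefficient `d_l` of `t^l` in `det X(t)`. For `l < k` it does not matter whether the
determinant is taken in `S[t]` or in `S[t]/(t^k)`. -/
def detCoeff (F : Type*) [Field F] (m k l : ℕ) : PolyRing F m k :=
  (genericMatrix F m k).det.coeff l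

/-- The ideal generated by `d_0, …, d_{k-1}`. -/
def detIdeal (F : Type*) [Field F] (m k : ℕ) : Ideal (PolyRing F m k) :=
  Ideal.span (Set.range fun l : Fin k => detCoeff F m k l)

/-- The variety in the affine space `F^{m²k}` that is cut out by `detIdeal F m k`. -/
def detVariety (F : Type*) [Field F] (m k : ℕ) : Set (Vars m k → F) :=
  MvPolynomial.zeroLocus F (detIdeal F m k)

/-- The coordinate ring of `detVariety F m k`: polynomials modulo those that vanish on it. -/
abbrev coordRing (F : Type*) [Field F] (m k : ℕ) : Type _ :=
  PolyRing F m k ⧸ MvPolynomial.vanishingIdeal F (detVariety F m k)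

/-- An algebra over a field `F` is a complete intersection if it is isomorphic to the quotient of
a polynomial ring in finitely many variables over `F` by an ideal generated by a regular
sequence. -/
def IsCompleteIntersection (F R : Type*) [Field F] [CommRing R] [Algebra F R] : Prop :=
  ∃ (n : ℕ) (f : List (MvPolynomial (Fin n) F)),
    RingTheory.Sequence.IsRegular (MvPolynomial (Fin n) F) f ∧
    Nonempty (R ≃ₐ[F] (MvPolynomial (Fin n) F ⧸ Ideal.ofList f))

/-- The depth of an ideal `P` on the ring `R`: the supremum of the lengths of the regular
sequences on `R` that consist of elements of `P`. -/
def idealDepth {R : Type*} [CommRing R] (P : Ideal R) : ℕ∞ :=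
  ⨆ f : {f : List R // RingTheory.Sequence.IsRegular R f ∧ ∀ a ∈ f, a ∈ P}, (f.1.length : ℕ∞)

/-- A Noetherian ring is Cohen-Macaulay if the depth of every maximal ideal is equal to its
height (codimension). -/
def IsCohenMacaulay (R : Type*) [CommRing R] : Prop :=
  IsNoetherianRing R ∧ ∀ P : Ideal R, P.IsMaximal → idealDepth P = P.height

end TruncDet

end

noncomputable section

namespace TruncDet

open MvPolynomial

/-! Give x_{i,j}^{(l)} the position m*l + j in row i. The monomials of d_l are the transversals
whose differences "position minus row" sum to m*l. The l-th diagonal, where all differences equal l,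
is one of them, and strict concavity of B^2 - a^2 makes it the unique one of largest weight
(`sum_diagWeight_lt`). Adding to every other variable of a diagonal l < k its row-0 variable, the
pivot, turns the leading term of d_l into plus or minus the m-th power of the pivot
(`shear_genCoeff`). Hence S is free over the polynomial ring in the d_l and the remaining linear
forms (`flat_param`), and by flatness the d_l followed by these forms minus arbitrary constants are
weakly regular (`isWeaklyRegular_param`).

The rest follows from this. For primality, induct on m over all domains: the lower left entry of
X(0) lies below all the diagonals, so it is a nonzerodivisor modulo the ideal; once it is inverted,
a Schur complement and a translation leave the ideal of size m - 1 (`exists_map_genIdeal_eq`), so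
the ideal is a contraction of a prime. The height is k by Krull's height theorem and regularity. At
a closed point, the linear forms minus their values there are a regular sequence at least as long as
the height, which gives Cohen-Macaulayness. The Nullstellensatz identifies the vanishing ideal. -/

/-! ### Triangular maps and flatness. -/

/-- A linear endomorphism that differs from the identity by a map strictly lowering an exhaustive
filtration indexed by `ℕ` is bijective. -/
theorem bijective_of_sub_mem_filtration {R M : Type*} [CommRing R] [AddCommGroup M] [Module R M]
    (F : ℕ → Submodule R M) (h0 : F 0 = ⊥) (hF : ∀ x, ∃ n, x ∈ F n) (Φ : M →ₗ[R] M)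
    (h : ∀ n, ∀ x ∈ F (n + 1), Φ x - x ∈ F n) : Function.Bijective Φ := by
  constructor
  · rw [injective_iff_map_eq_zero]
    intro x hx
    obtain ⟨n, hn⟩ := hF x
    induction n with
    | zero => simpa [h0] using hn
    | succ n ih =>
      have := h n x hn
      rw [hx, zero_sub, neg_mem_iff] at this
      exact ih this
  · intro x
    obtain ⟨n, hn⟩ := hF x
    induction n generalizing x with
    | zero => exact ⟨0, by rw [map_zero]; simpa [h0, eq_comm] using hn⟩
    | succ n ih =>
      obtain ⟨y, hy⟩ := ih _ (h n x hn)
      exact ⟨x - y, by rw [map_sub, hy, sub_sub_cancel]⟩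

/-- A linear map that sends a basis to unit multiples of another basis, up to terms of smaller
degree, is bijective. -/
theorem bijective_of_basis_lead {R M N ι ι' : Type*} [CommRing R] [AddCommGroup M] [Module R M]
    [AddCommGroup N] [Module R N] (b : Module.Basis ι R M) (b' : Module.Basis ι' R N)
    (e : ι ≃ ι') (u : ι → Rˣ) (deg : ι' → ℕ) (Ψ : M →ₗ[R] N)
    (h : ∀ i, Ψ (b i) - u i • b' (e i) ∈
      Submodule.span R (b' '' {j | deg j < deg (e i)})) : Function.Bijective Ψ := by
  -- `E` sends each `b i` to its exact leading term, so `Ψ ∘ E⁻¹` is the identity plus a map that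
  -- lowers the degree.
  let E : M ≃ₗ[R] N := b.equiv ((b'.reindex e.symm).unitsSMul u) (Equiv.refl _)
  have hE : ∀ i, E (b i) = u i • b' (e i) := fun i => by
    simp [E, Module.Basis.equiv_apply, Module.Basis.unitsSMul_apply]
  have key : Function.Bijective (Ψ ∘ₗ E.symm.toLinearMap) := by
    refine bijective_of_sub_mem_filtration
      (fun n => Submodule.span R (b' '' {j | deg j < n})) (by simp) ?_ _ ?_
    · intro x
      refine ⟨(b'.repr x).support.sup deg + 1, ?_⟩
      rw [Module.Basis.mem_span_image]
      intro j hj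
      exact Nat.lt_succ_of_le (Finset.le_sup (f := deg) hj)
    · intro n x hx
      induction hx using Submodule.span_induction with
      | mem x hx =>
        obtain ⟨j, hj, rfl⟩ := hx
        obtain ⟨i, rfl⟩ := e.surjective j
        have h1 : E.symm (b' (e i)) = (u i)⁻¹ • b i := by
          rw [LinearEquiv.symm_apply_eq, Units.smul_def, map_smul, hE, ← Units.smul_def,
            inv_smul_smul]
        have h2 : (Ψ ∘ₗ E.symm.toLinearMap) (b' (e i)) - b' (e i) =
            ((u i)⁻¹ : Rˣ) • (Ψ (b i) - u i • b' (e i)) := by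
          rw [smul_sub, inv_smul_smul]
          simp [h1, Units.smul_def]
        rw [h2, Units.smul_def]
        refine Submodule.smul_mem _ _ (Submodule.span_mono ?_ (h i))
        refine Set.image_mono fun j' hj' => ?_
        exact lt_of_lt_of_le hj' (Nat.lt_succ_iff.mp hj)
      | zero => simp
      | add x y _ _ hx hy =>
        rw [map_add, add_sub_add_comm]
        exact add_mem hx hy
      | smul a x _ hx =>
        rw [map_smul, ← smul_sub]
        exact Submodule.smul_mem _ _ hx
  have : (Ψ : M → N) = (Ψ ∘ₗ E.symm.toLinearMap) ∘ E := by ext x; simp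
  rw [this]
  exact key.comp E.bijective

/-- Bijectivity says that the `g i` are a basis of `S` over `B`, and free modules are flat. -/
theorem flat_of_bijective_sum {B S ι : Type*} [CommRing B] [CommRing S] [Fintype ι]
    (φ : B →+* S) (g : ι → S)
    (h : Function.Bijective fun c : ι → B => ∑ i, φ (c i) * g i) : φ.Flat := by
  let := φ.toAlgebra
  let f : (ι → B) →ₗ[B] S :=
    { toFun := fun c => ∑ i, φ (c i) * g i
      map_add' := fun c d => by simp [add_mul, Finset.sum_add_distrib]
      map_smul' := fun r c => by
        simp [Algebra.smul_def, RingHom.algebraMap_toAlgebra, Finset.mul_sum, mul_assoc] }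
  exact Module.Flat.of_linearEquiv (LinearEquiv.ofBijective f h).symm

/-! ### Weight filtrations and leading terms. -/

section Weights

variable {σ R : Type*} [CommRing R]

/-- The polynomials all of whose monomials have `w`-weight less than `d`. -/
def weightLT (R : Type*) [CommRing R] (w : σ → ℕ) (d : ℕ) : Submodule R (MvPolynomial σ R) :=
  restrictSupport R {α | Finsupp.weight w α < d}

theorem weightLT_mono (w : σ → ℕ) {a b : ℕ} (h : a ≤ b) : weightLT R w a ≤ weightLT R w b :=
  restrictSupport_mono R fun _ hα => lt_of_lt_of_le hα h

theorem mul_mem_weightLT {w : σ → ℕ} {a b : ℕ} {p q : MvPolynomial σ R}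
    (hp : p ∈ weightLT R w (a + 1)) (hq : q ∈ weightLT R w b) : p * q ∈ weightLT R w (a + b) := by
  have h := Submodule.mul_mem_mul hp hq
  rw [weightLT, weightLT, ← restrictSupport_add] at h
  refine restrictSupport_mono R ?_ h
  rintro _ ⟨α, hα, β, hβ, rfl⟩
  simp only [Set.mem_ofPred_eq, map_add] at *
  omega

theorem monomial_mem_weightLT {w : σ → ℕ} {d : ℕ} {α : σ →₀ ℕ} (r : R)
    (h : Finsupp.weight w α < d) : monomial α r ∈ weightLT R w d :=
  (monomial_mem_restrictSupport R).2 (Or.inl h)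

theorem X_mem_weightLT {w : σ → ℕ} {d : ℕ} {v : σ} (h : w v < d) :
    (X v : MvPolynomial σ R) ∈ weightLT R w d :=
  monomial_mem_weightLT 1 (by simpa [Finsupp.weight_single] using h)

/-- `p'` has weight at most `d`, and `p` and `p'` agree up to terms of weight less than `d`. -/
def LeadsTo (w : σ → ℕ) (d : ℕ) (p p' : MvPolynomial σ R) : Prop :=
  p' ∈ weightLT R w (d + 1) ∧ p - p' ∈ weightLT R w d

theorem LeadsTo.mem {w : σ → ℕ} {d : ℕ} {p p' : MvPolynomial σ R} (h : LeadsTo w d p p') :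
    p ∈ weightLT R w (d + 1) := by
  rw [← sub_add_cancel p p']
  exact add_mem (weightLT_mono w (Nat.le_succ d) h.2) h.1

theorem LeadsTo.refl {w : σ → ℕ} {d : ℕ} {p : MvPolynomial σ R}
    (h : p ∈ weightLT R w (d + 1)) : LeadsTo w d p p :=
  ⟨h, by simp⟩

theorem LeadsTo.mul {w : σ → ℕ} {a b : ℕ} {p p' q q' : MvPolynomial σ R}
    (hp : LeadsTo w a p p') (hq : LeadsTo w b q q') : LeadsTo w (a + b) (p * q) (p' * q') := by
  refine ⟨mul_mem_weightLT (b := b + 1) hp.1 hq.1, ?_⟩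
  have : p * q - p' * q' = q * (p - p') + p' * (q - q') := by ring
  rw [this]
  refine add_mem ?_ (mul_mem_weightLT hp.1 hq.2)
  rw [add_comm a b]
  exact mul_mem_weightLT hq.mem hp.2

theorem LeadsTo.one {w : σ → ℕ} : LeadsTo w 0 (1 : MvPolynomial σ R) 1 :=
  .refl (monomial_mem_weightLT (α := 0) 1 (by simp))

theorem LeadsTo.C_mul {w : σ → ℕ} {a : ℕ} {p p' : MvPolynomial σ R} (r : R)
    (hp : LeadsTo w a p p') : LeadsTo w a (C r * p) (C r * p') := by
  simp only [← smul_eq_C_mul]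
  exact ⟨Submodule.smul_mem _ _ hp.1, by rw [← smul_sub]; exact Submodule.smul_mem _ _ hp.2⟩

theorem LeadsTo.pow {w : σ → ℕ} {a : ℕ} {p p' : MvPolynomial σ R}
    (hp : LeadsTo w a p p') (n : ℕ) : LeadsTo w (n * a) (p ^ n) (p' ^ n) := by
  induction n with
  | zero => simpa using LeadsTo.one
  | succ n ih =>
    rw [pow_succ, pow_succ, add_mul, one_mul]
    exact ih.mul hp

theorem LeadsTo.prod {w : σ → ℕ} {ι : Type*} (s : Finset ι) {a : ι → ℕ}
    {p p' : ι → MvPolynomial σ R} (h : ∀ i ∈ s, LeadsTo w (a i) (p i) (p' i)) :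
    LeadsTo w (∑ i ∈ s, a i) (∏ i ∈ s, p i) (∏ i ∈ s, p' i) := by
  classical
  induction s using Finset.induction_on with
  | empty => simpa using LeadsTo.one
  | insert i s hi ih =>
    rw [Finset.sum_insert hi, Finset.prod_insert hi, Finset.prod_insert hi]
    exact (h i (Finset.mem_insert_self i s)).mul
      (ih fun j hj => h j (Finset.mem_insert_of_mem hj))

/-- Division with remainder of exponents: `q, r ↦ n q + r`. -/
def exponentDivMod [Fintype σ] (n : σ → ℕ) (hn : ∀ v, 0 < n v) :
    (Σ _ : (∀ v, Fin (n v)), σ →₀ ℕ) ≃ (σ →₀ ℕ) where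
  toFun x := Finsupp.equivFunOnFinite.symm fun v => n v * x.2 v + x.1 v
  invFun α := ⟨fun v => ⟨α v % n v, Nat.mod_lt _ (hn v)⟩,
    Finsupp.equivFunOnFinite.symm fun v => α v / n v⟩
  left_inv := by
    rintro ⟨r, q⟩
    refine Sigma.ext (funext fun v => Fin.ext ?_) (heq_of_eq (Finsupp.ext fun v => ?_))
    · simp [Nat.mod_eq_of_lt (r v).2]
    · simp [Nat.mul_add_div (hn v), Nat.div_eq_of_lt (r v).2]
  right_inv α := by
    ext v
    simp [Nat.div_add_mod]

/-- If `f v` has leading term a unit times a positive power of `X v`, for every variable `v`, then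
the polynomial ring is flat over itself by means of `X v ↦ f v`. -/
theorem flat_aeval_of_leadsTo [Fintype σ] (w n : σ → ℕ) (hn : ∀ v, 0 < n v) (u : σ → Rˣ)
    (f : σ → MvPolynomial σ R)
    (hf : ∀ v, LeadsTo w (n v * w v) (f v) (C (u v : R) * X v ^ n v)) :
    (aeval f : MvPolynomial σ R →ₐ[R] MvPolynomial σ R).toRingHom.Flat := by
  classical
  -- The monomials with all exponents below `n v` will be a basis over the subring generated by the
  -- `f v`.
  let z : (∀ v, Fin (n v)) → MvPolynomial σ R := fun r => ∏ v, X v ^ (r v : ℕ)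
  let Ψ : ((∀ v, Fin (n v)) → MvPolynomial σ R) →ₗ[R] MvPolynomial σ R :=
    ∑ r, (LinearMap.mulRight R (z r)) ∘ₗ (aeval f).toLinearMap ∘ₗ LinearMap.proj r
  have hΨ : ∀ c, Ψ c = ∑ r, aeval f (c r) * z r := fun c => by simp [Ψ]
  refine flat_of_bijective_sum _ z ?_
  have : (fun c : (∀ v, Fin (n v)) → MvPolynomial σ R =>
      ∑ i, (aeval f : MvPolynomial σ R →ₐ[R] MvPolynomial σ R).toRingHom (c i) * z i) = Ψ := by
    ext1 c; rw [hΨ]; rfl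
  rw [this]
  refine bijective_of_basis_lead (Pi.basis fun _ => basisMonomials σ R) (basisMonomials σ R)
    (exponentDivMod n hn) (fun x => ∏ v, u v ^ x.2 v) (Finsupp.weight w) Ψ ?_
  rintro ⟨r, q⟩
  have h1 : Ψ ((Pi.basis fun _ => basisMonomials σ R) ⟨r, q⟩) = (∏ v, f v ^ q v) * z r := by
    rw [hΨ, Finset.sum_eq_single r]
    · rw [Pi.basis_apply, Pi.single_eq_same, coe_basisMonomials, aeval_monomial, map_one, one_mul,
        Finsupp.prod_fintype _ _ (by simp)]
    · intro r' _ hr'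
      rw [Pi.basis_apply, Pi.single_eq_of_ne hr', map_zero, zero_mul]
    · simp
  have h2 := (LeadsTo.prod Finset.univ fun v _ => (hf v).pow (q v)).mul
    (LeadsTo.prod Finset.univ fun v _ =>
      (LeadsTo.refl (X_mem_weightLT (R := R) (Nat.lt_succ_self (w v)))).pow (r v : ℕ))
  have h3 : (∏ v, (C (u v : R) * X v ^ n v) ^ q v) * (∏ v, (X v : MvPolynomial σ R) ^ (r v : ℕ)) =
      (∏ v, u v ^ q v) • basisMonomials σ R (exponentDivMod n hn ⟨r, q⟩) := by
    have h : basisMonomials σ R (exponentDivMod n hn ⟨r, q⟩) =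
        ∏ v, (X v : MvPolynomial σ R) ^ (n v * q v + r v) := by
      rw [coe_basisMonomials]
      beta_reduce
      rw [monomial_eq, C_1, one_mul, Finsupp.prod_fintype _ _ (by simp)]
      rfl
    rw [h, Units.smul_def, smul_eq_C_mul, Units.coe_prod, map_prod, ← Finset.prod_mul_distrib,
      ← Finset.prod_mul_distrib]
    refine Finset.prod_congr rfl fun v _ => ?_
    rw [Units.val_pow_eq_pow_val, map_pow]
    ring
  have h4 : ∑ v, q v * (n v * w v) + ∑ v, (r v : ℕ) * w v =
      Finsupp.weight w (exponentDivMod n hn ⟨r, q⟩) := by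
    rw [Finsupp.weight_apply, Finsupp.sum_fintype _ _ (by simp), ← Finset.sum_add_distrib]
    refine Finset.sum_congr rfl fun v _ => ?_
    simp only [exponentDivMod, Equiv.coe_fn_mk, Finsupp.equivFunOnFinite_symm_apply_apply,
      smul_eq_mul]
    ring
  rw [h1, ← h3, ← h4]
  have := h2.2
  rw [weightLT, restrictSupport_eq_span] at this
  simpa using this

end Weights

/-! ### Regular sequences of translated variables. -/

theorem isWeaklyRegular_map_of_flat {B S : Type*} [CommRing B] [CommRing S] {φ : B →+* S}
    (hφ : φ.Flat) {rs : List B} (h : RingTheory.Sequence.IsWeaklyRegular B rs) :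
    RingTheory.Sequence.IsWeaklyRegular S (rs.map φ) := by
  let := φ.toAlgebra
  have : Module.Flat B S := hφ
  exact h.of_flat

-- Substituting constants for the variables already used is a retraction whose kernel is the ideal
-- generated so far. It fixes the next element, which is nonzero in a domain.
open RingTheory.Sequence in
theorem isWeaklyRegular_X_sub_C {σ R : Type*} [CommRing R] [IsDomain R] (c : σ → R) (l : List σ)
    (hl : l.Nodup) :
    IsWeaklyRegular (MvPolynomial σ R) (l.map fun v => X v - C (c v)) := by
  classical
  constructor
  intro i hi
  rw [List.length_map] at hi
  rw [isSMulRegular_quotient_iff_mem_of_smul_mem]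
  intro f hf
  rw [List.getElem_map, Ideal.smul_eq_mul, Ideal.mul_top, smul_eq_mul] at hf
  rw [Ideal.smul_eq_mul, Ideal.mul_top]
  set J := Ideal.ofList ((l.map fun v => X v - C (c v)).take i) with hJ
  let ρ : MvPolynomial σ R →ₐ[R] MvPolynomial σ R :=
    aeval fun v => if v ∈ l.take i then C (c v) else X v
  have hρJ : ∀ p ∈ J, ρ p = 0 := by
    intro p hp
    have : J ≤ RingHom.ker ρ := by
      refine Ideal.span_le.mpr fun x hx => ?_
      rw [Set.mem_ofPred_eq, ← List.map_take] at hx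
      obtain ⟨v, hv, rfl⟩ := List.mem_map.mp hx
      simp [ρ, hv, RingHom.mem_ker]
    exact this hp
  have hJρ : ∀ p, ρ p - p ∈ J := by
    intro p
    induction p using MvPolynomial.induction_on with
    | C a => simp [ρ]
    | add p q hp hq =>
      rw [map_add, add_sub_add_comm]
      exact add_mem hp hq
    | mul_X p v hp =>
      have hv : ρ (X v) - X v ∈ J := by
        by_cases h : v ∈ l.take i
        · rw [← neg_sub, neg_mem_iff]
          refine Ideal.subset_span ?_
          rw [Set.mem_ofPred_eq, ← List.map_take]
          simpa [ρ, h] using List.mem_map_of_mem (f := fun v => X v - C (c v)) h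
        · simp [ρ, h]
      have : ρ (p * X v) - p * X v = (ρ p - p) * ρ (X v) + p * (ρ (X v) - X v) := by
        rw [map_mul]; ring
      rw [this]
      exact add_mem (J.mul_mem_right _ hp) (J.mul_mem_left _ hv)
  have hne : l[i] ∉ l.take i := by
    intro h
    obtain ⟨j, hj, hji⟩ := List.mem_take_iff_getElem.mp h
    have := (hl.getElem_inj_iff).mp hji
    omega
  have h0 := hρJ _ hf
  have hX : (X l[i] - C (c l[i]) : MvPolynomial σ R) ≠ 0 := by
    intro h
    have := congrArg (coeff (Finsupp.single l[i] 1)) h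
    rw [coeff_sub, coeff_C, if_neg (Finsupp.single_ne_zero.mpr one_ne_zero).symm] at this
    simp at this
  rw [map_mul] at h0
  have h1 : ρ (X l[i] - C (c l[i])) = X l[i] - C (c l[i]) := by
    simp [ρ, hne]
  rw [h1] at h0
  have h2 := (mul_eq_zero.mp h0).resolve_left hX
  have h3 := hJρ f
  rwa [h2, zero_sub, neg_mem_iff] at h3

/-! ### The generic determinant over an arbitrary ring. -/

section Generic

variable (R : Type*) [CommRing R] (m k : ℕ)

/-- The generic matrix over an arbitrary coefficient ring. -/
def genMatrix : Matrix (Fin m) (Fin m) (Polynomial (MvPolynomial (Vars m k) R)) :=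
  Matrix.of fun i j =>
    ∑ l : Fin k, Polynomial.C (MvPolynomial.X (i, j, l)) * Polynomial.X ^ (l : ℕ)

/-- The coefficients of the generic determinant over an arbitrary coefficient ring. -/
def genCoeff (l : ℕ) : MvPolynomial (Vars m k) R :=
  (genMatrix R m k).det.coeff l

/-- The ideal of the first `k` coefficients, over an arbitrary coefficient ring. -/
def genIdeal : Ideal (MvPolynomial (Vars m k) R) :=
  Ideal.span (Set.range fun l : Fin k => genCoeff R m k l)

theorem ofList_genCoeff :
    Ideal.ofList (List.ofFn fun i : Fin k => genCoeff R m k i) = genIdeal R m k := by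
  rw [Ideal.ofList, genIdeal]
  congr 1
  ext x
  simp [List.mem_ofFn]

theorem genCoeff_eq_sum (l : ℕ) :
    genCoeff R m k l = ∑ x : Equiv.Perm (Fin m) × (Fin m → Fin k),
      if ∑ i, (x.2 i : ℕ) = l then
        C ((Equiv.Perm.sign x.1 : ℤ) : R) * ∏ i, X (i, x.1 i, x.2 i) else 0 := by
  rw [genCoeff, ← Matrix.det_transpose, Matrix.det_apply', Polynomial.finsetSum_coeff,
    Fintype.sum_prod_type]
  refine Finset.sum_congr rfl fun σ _ => ?_
  have h : ∏ i, (genMatrix R m k).transpose (σ i) i =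
      ∑ q : Fin m → Fin k, Polynomial.C (∏ i, X (i, σ i, q i)) *
        Polynomial.X ^ (∑ i, (q i : ℕ)) := by
    simp only [genMatrix, Matrix.transpose_apply, Matrix.of_apply]
    rw [Finset.prod_univ_sum]
    refine Finset.sum_congr (by simp) fun q _ => ?_
    rw [Finset.prod_mul_distrib, Finset.prod_pow_eq_pow_sum, map_prod]
  rw [h, ← map_intCast (Polynomial.C (R := MvPolynomial (Vars m k) R)), Polynomial.coeff_C_mul, Polynomial.finsetSum_coeff,
    Finset.mul_sum]
  refine Finset.sum_congr rfl fun q _ => ?_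
  rw [Polynomial.coeff_C_mul_X_pow]
  simp only [eq_comm (a := l)]
  split_ifs <;> simp

end Generic

/-! ### Diagonals and the concave weight. -/

section Diagonals

variable {m k : ℕ}

/-- Column and exponent of `t` of a variable combined: the exponent of `t` when the `j`-th column
of the matrix is multiplied by `t ^ j` and `t` is replaced by `t ^ m`. -/
def colPos (v : Vars m k) : ℕ := m * v.2.2 + v.2.1

/-- The variable in row `i` of the `l`-th diagonal. -/
def diagVar (l : Fin k) (i : Fin (m + 1)) : Vars (m + 1) k :=
  (i, ⟨(i + l) % (m + 1), Nat.mod_lt _ m.succ_pos⟩, ⟨(i + l) / (m + 1), by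
    rw [Nat.div_lt_iff_lt_mul m.succ_pos]
    have := i.2
    have := l.2
    nlinarith⟩)

theorem colPos_diagVar (l : Fin k) (i : Fin (m + 1)) : colPos (diagVar l i) = i + l :=
  Nat.div_add_mod _ _

theorem eq_diagVar {v : Vars (m + 1) k} {l : Fin k} (h : colPos v = v.1 + l) :
    v = diagVar l v.1 := by
  obtain ⟨i, j, q⟩ := v
  simp only [colPos] at h
  refine Prod.ext rfl (Prod.ext (Fin.ext ?_) (Fin.ext ?_))
  · simp [diagVar, ← h, Nat.mod_eq_of_lt j.2]
  · simp [diagVar, ← h, Nat.mul_add_div, Nat.div_eq_of_lt j.2]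

/-- The variable lies on one of the diagonals `0, …, k - 1`. -/
def OnDiag (v : Vars m k) : Prop := v.1 ≤ colPos v ∧ colPos v < v.1 + k

instance (v : Vars m k) : Decidable (OnDiag v) := inferInstanceAs (Decidable (_ ∧ _))

theorem onDiag_diagVar (l : Fin k) (i : Fin (m + 1)) : OnDiag (diagVar l i) := by
  rw [OnDiag, colPos_diagVar]
  exact ⟨Nat.le_add_right _ _, Nat.add_lt_add_left l.2 _⟩

/-- The number of the diagonal of a variable. -/
def diagIndex (v : Vars m k) (h : OnDiag v) : Fin k := ⟨colPos v - v.1, by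
  have := h.1; have := h.2; omega⟩

theorem diagVar_diagIndex (v : Vars (m + 1) k) (h : OnDiag v) :
    diagVar (diagIndex v h) v.1 = v :=
  (eq_diagVar (by have := h.1; simp only [diagIndex]; omega)).symm

theorem diagIndex_diagVar (l : Fin k) (i : Fin (m + 1)) (h : OnDiag (diagVar l i)) :
    diagIndex (diagVar l i) h = l := by
  ext
  simp only [diagIndex, colPos_diagVar]
  simp [diagVar]

/-- The variable is the first one on one of the diagonals `0, …, k - 1`. -/
def IsPivot (v : Vars (m + 1) k) : Prop := v.1 = 0 ∧ OnDiag v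

instance (v : Vars (m + 1) k) : Decidable (IsPivot v) := inferInstanceAs (Decidable (_ ∧ _))

theorem isPivot_diagVar (l : Fin k) : IsPivot (diagVar (m := m) l 0) := ⟨rfl, onDiag_diagVar l 0⟩

theorem IsPivot.eq {v : Vars (m + 1) k} (h : IsPivot v) : v = diagVar (diagIndex v h.2) 0 :=
  (diagVar_diagIndex v h.2).symm.trans (congrArg _ h.1)

/-- An upper bound for the number of a diagonal. -/
def diagBound (m k : ℕ) : ℕ := (m + 1) * (k + 1)

/-- A concave function of the diagonal of a variable. -/
def diagWeight (v : Vars (m + 1) k) : ℕ :=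
  diagBound m k ^ 2 - ((colPos v : ℤ) - (v.1 : ℕ)).natAbs ^ 2

/-- `diagBound` exceeds every |position - row|, so the natural subtraction does not truncate.
Positivity makes non-pivots, of `pivotWeight` 0, strictly lighter than pivots. -/
theorem diagWeight_cast (v : Vars (m + 1) k) :
    (diagWeight v : ℤ) = (diagBound m k : ℤ) ^ 2 - ((colPos v : ℤ) - (v.1 : ℕ)) ^ 2 ∧
      0 < diagWeight v := by
  have h : ((colPos v : ℤ) - (v.1 : ℕ)).natAbs < diagBound m k := by
    obtain ⟨i, j, q⟩ := v
    have hi := i.2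
    have hj := j.2
    have hq := q.2
    have h1 : (m + 1) * (q : ℕ) + (m + 1) ≤ (m + 1) * k := by nlinarith
    simp only [colPos, diagBound, Nat.mul_succ]
    omega
  have h2 : ((colPos v : ℤ) - (v.1 : ℕ)).natAbs ^ 2 < diagBound m k ^ 2 :=
    Nat.pow_lt_pow_left h two_ne_zero
  constructor
  · rw [diagWeight, Nat.cast_sub h2.le]
    simp
  · exact Nat.sub_pos_of_lt h2

/-- The weights for which the powers of the pivots are the leading terms. -/
def pivotWeight (v : Vars (m + 1) k) : ℕ := if IsPivot v then diagWeight v else 0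

theorem pivotWeight_le (v : Vars (m + 1) k) : pivotWeight v ≤ diagWeight v := by
  rw [pivotWeight]
  split_ifs <;> simp

theorem diagWeight_diagVar (l : Fin k) (i : Fin (m + 1)) :
    diagWeight (diagVar l i) = diagWeight (diagVar (m := m) l 0) := by
  simp only [diagWeight, colPos_diagVar]
  simp [diagVar]

theorem pivotWeight_diagVar (l : Fin k) :
    pivotWeight (diagVar (m := m) l 0) = diagWeight (diagVar (m := m) l 0) :=
  if_pos (isPivot_diagVar l)

/-- The concavity of the weights: a transversal of weight `l` that is not the `l`-th diagonal has
smaller weight than the diagonal. -/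
theorem sum_diagWeight_lt (l : Fin k) (σ : Equiv.Perm (Fin (m + 1))) (q : Fin (m + 1) → Fin k)
    (hq : ∑ i, (q i : ℕ) = l) (hne : ∃ i, (i, σ i, q i) ≠ diagVar l i) :
    ∑ i, diagWeight (i, σ i, q i) < (m + 1) * diagWeight (diagVar (m := m) l 0) := by
  set a : Fin (m + 1) → ℤ := fun i => (colPos (i, σ i, q i) : ℤ) - (i : ℕ) with ha
  -- `a i` is the diagonal of the entry chosen in row `i`; the columns of a permutation cancel
  -- against the rows, so the mean of the `a i` is `l`.
  have hsum : ∑ i, a i = (m + 1) * l := by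
    have h1 : ∀ i, a i = (m + 1) * (q i : ℕ) + ((σ i : ℕ) - (i : ℕ) : ℤ) := fun i => by
      simp only [ha, colPos]
      push_cast
      ring
    have h2 : ∑ i, ((σ i : ℕ) : ℤ) = ∑ i, ((i : Fin (m + 1)) : ℕ) :=by
      rw [Equiv.sum_comp σ fun i => ((i : ℕ) : ℤ)]; simp
    have h3 : ∑ i, ((q i : ℕ) : ℤ) = l := by exact_mod_cast hq
    rw [Finset.sum_congr rfl fun i _ => h1 i, Finset.sum_add_distrib, ← Finset.mul_sum, h3,
      Finset.sum_sub_distrib, h2]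
    simp
  -- The variance of the `a i` is exactly the loss of weight; it vanishes only on the `l`-th
  -- diagonal.
  have hpos : 0 < ∑ i, (a i - l) ^ 2 := by
    obtain ⟨i, hi⟩ := hne
    refine Finset.sum_pos' (fun i _ => sq_nonneg _) ⟨i, Finset.mem_univ i, ?_⟩
    refine sq_pos_iff.mpr ?_
    intro h
    refine hi (eq_diagVar (v := (i, σ i, q i)) ?_)
    simp only [ha] at h
    dsimp only
    omega
  have hexp : ∑ i, (a i - l) ^ 2 = ∑ i, a i ^ 2 - (m + 1) * (l : ℤ) ^ 2 := by
    have : ∀ i, (a i - l) ^ 2 = a i ^ 2 - 2 * l * a i + (l : ℤ) ^ 2 := fun i => by ring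
    rw [Finset.sum_congr rfl fun i _ => this i, Finset.sum_add_distrib, Finset.sum_sub_distrib,
      ← Finset.mul_sum, hsum]
    simp
    ring
  have h1 : (∑ i, diagWeight (i, σ i, q i) : ℤ) =
      (m + 1) * (diagBound m k : ℤ) ^ 2 - ∑ i, a i ^ 2 := by
    rw [Finset.sum_congr rfl fun i _ => (diagWeight_cast (i, σ i, q i)).1, Finset.sum_sub_distrib]
    simp [ha]
  have h2 := (diagWeight_cast (diagVar (m := m) l 0)).1
  rw [colPos_diagVar] at h2
  zify
  rw [h1, h2]
  simp [diagVar]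
  nlinarith

end Diagonals

/-! ### Shearing the coordinates and the resulting regular sequence. -/

section Leading

variable (R : Type*) [CommRing R] {m k : ℕ}

/-- The pivot on the diagonal of a variable that is on one of the diagonals `0, …, k - 1` and not
a pivot, and `0` for the other variables. -/
def shift (v : Vars (m + 1) k) : MvPolynomial (Vars (m + 1) k) R :=
  if h : v.1 ≠ 0 ∧ OnDiag v then X (diagVar (diagIndex v h.2) 0) else 0

theorem shift_of_isPivot {v : Vars (m + 1) k} (h : IsPivot v) : shift R v = 0 :=
  dif_neg fun h' => h'.1 h.1

/-- The linear change of coordinates that adds the pivot to the other variables on a diagonal. -/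
def shear : MvPolynomial (Vars (m + 1) k) R →ₐ[R] MvPolynomial (Vars (m + 1) k) R :=
  aeval fun v => X v + shift R v

/-- The inverse of `shear`. -/
def unshear : MvPolynomial (Vars (m + 1) k) R →ₐ[R] MvPolynomial (Vars (m + 1) k) R :=
  aeval fun v => X v - shift R v

theorem shear_shift (v : Vars (m + 1) k) : shear R (shift R v) = shift R v := by
  unfold shift
  split_ifs
  · rw [shear, aeval_X, shift_of_isPivot R (isPivot_diagVar _), add_zero]
  · simp

theorem unshear_shift (v : Vars (m + 1) k) : unshear R (shift R v) = shift R v := by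
  unfold shift
  split_ifs
  · rw [unshear, aeval_X, shift_of_isPivot R (isPivot_diagVar _), sub_zero]
  · simp

theorem shear_X (v : Vars (m + 1) k) : shear R (X v) = X v + shift R v := aeval_X _ _

theorem unshear_X (v : Vars (m + 1) k) : unshear R (X v) = X v - shift R v := aeval_X _ _

theorem unshear_shear (p : MvPolynomial (Vars (m + 1) k) R) : unshear R (shear R p) = p := by
  have : (unshear R).comp (shear R) = AlgHom.id R (MvPolynomial (Vars (m + 1) k) R) := by
    ext1 v
    simp [shear_X, unshear_X, unshear_shift]
  exact DFunLike.congr_fun this p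

theorem shear_unshear (p : MvPolynomial (Vars (m + 1) k) R) : shear R (unshear R p) = p := by
  have : (shear R).comp (unshear R) = AlgHom.id R (MvPolynomial (Vars (m + 1) k) R) := by
    ext1 v
    simp [shear_X, unshear_X, shear_shift]
  exact DFunLike.congr_fun this p

/-- A pivot that is added lies on the same diagonal as `v`, and `diagWeight` depends only on the
diagonal. -/
theorem shear_X_mem (v : Vars (m + 1) k) :
    shear R (X v) ∈ weightLT R pivotWeight (diagWeight v + 1) := by
  rw [shear_X]
  refine add_mem (X_mem_weightLT (Nat.lt_succ_of_le (pivotWeight_le v))) ?_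
  unfold shift
  split_ifs with h
  · refine X_mem_weightLT ?_
    rw [pivotWeight_diagVar, ← diagWeight_diagVar _ v.1, diagVar_diagIndex]
    exact Nat.lt_succ_self _
  · exact zero_mem _

theorem shear_X_diagVar (l : Fin k) (i : Fin (m + 1)) :
    LeadsTo pivotWeight (diagWeight (diagVar (m := m) l 0)) (shear R (X (diagVar l i)))
      (X (diagVar l 0)) := by
  have h1 : LeadsTo pivotWeight (diagWeight (diagVar (m := m) l 0)) (X (diagVar l 0))
      (X (diagVar l 0) : MvPolynomial (Vars (m + 1) k) R) :=
    .refl (X_mem_weightLT (by rw [pivotWeight_diagVar]; exact Nat.lt_succ_self _))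
  by_cases hi : i = 0
  · subst hi
    rwa [shear_X, shift_of_isPivot R (isPivot_diagVar _), add_zero]
  · refine ⟨h1.1, ?_⟩
    rw [shear_X, shift, dif_pos ⟨hi, onDiag_diagVar l i⟩, diagIndex_diagVar, add_sub_cancel_right]
    refine X_mem_weightLT ?_
    rw [pivotWeight, if_neg fun h => hi h.1]
    exact (diagWeight_cast _).2

/-- The permutation of the `l`-th diagonal. -/
def diagPerm (m l : ℕ) : Equiv.Perm (Fin (m + 1)) := Equiv.addRight (Fin.ofNat (m + 1) l)

theorem diagVar_eq (l : Fin k) (i : Fin (m + 1)) :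
    diagVar l i = (i, diagPerm m l i, (diagVar l i).2.2) := by
  refine Prod.ext rfl (Prod.ext (Fin.ext ?_) rfl)
  simp [diagVar, diagPerm, Fin.val_add]

/-- Sum "position = row + l" over the rows: columns and rows have equal sums and cancel. -/
theorem sum_diagVar (l : Fin k) : ∑ i, ((diagVar (m := m) l i).2.2 : ℕ) = l := by
  have h1 : ∀ i, ((m + 1) * (diagVar (m := m) l i).2.2 + (diagPerm m l i : ℕ) : ℕ) = i + l := by
    intro i
    rw [← colPos_diagVar]
    conv_rhs => rw [diagVar_eq]
    rfl
  have h2 := Finset.sum_congr rfl fun i (_ : i ∈ Finset.univ) => h1 i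
  rw [Finset.sum_add_distrib, Finset.sum_add_distrib, ← Finset.mul_sum,
    Equiv.sum_comp (diagPerm m l) fun i => (i : ℕ)] at h2
  simp only [Finset.sum_const, Finset.card_univ, Fintype.card_fin, smul_eq_mul] at h2
  have h3 : (m + 1) * ∑ i, ((diagVar (m := m) l i).2.2 : ℕ) = (m + 1) * l := by omega
  exact Nat.eq_of_mul_eq_mul_left m.succ_pos h3

/-- The leading term of a coefficient of the determinant after the change of coordinates. -/
theorem shear_genCoeff (l : Fin k) :
    LeadsTo pivotWeight ((m + 1) * diagWeight (diagVar (m := m) l 0))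
      (shear R (genCoeff R (m + 1) k l))
      (C ((Equiv.Perm.sign (diagPerm m l) : ℤ) : R) * X (diagVar l 0) ^ (m + 1)) := by
  classical
  have hmain : LeadsTo pivotWeight ((m + 1) * diagWeight (diagVar (m := m) l 0))
      (C ((Equiv.Perm.sign (diagPerm m l) : ℤ) : R) * ∏ i, shear R (X (diagVar (m := m) l i)))
      (C ((Equiv.Perm.sign (diagPerm m l) : ℤ) : R) * X (diagVar l 0) ^ (m + 1)) := by
    have := (LeadsTo.prod Finset.univ fun i _ => shear_X_diagVar R (m := m) l i).C_mul
      ((Equiv.Perm.sign (diagPerm m l) : ℤ) : R)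
    simpa using this
  refine ⟨hmain.1, ?_⟩
  -- Isolate the transversal that is the `l`-th diagonal; all others have smaller weight.
  rw [genCoeff_eq_sum, map_sum, ← Finset.add_sum_erase _ _
    (Finset.mem_univ (diagPerm m l, fun i => (diagVar (m := m) l i).2.2)), if_pos (sum_diagVar l),
    map_mul, map_prod, add_sub_right_comm]
  refine add_mem ?_ (Submodule.sum_mem _ ?_)
  · have h : ∀ i, ((i, diagPerm m l i, (diagVar l i).2.2) : Vars (m + 1) k) = diagVar l i :=
      fun i => (diagVar_eq l i).symm
    simp only [h]
    have h' : shear R (C ((Equiv.Perm.sign (diagPerm m l) : ℤ) : R)) =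
        (C ((Equiv.Perm.sign (diagPerm m l) : ℤ) : R) : MvPolynomial (Vars (m + 1) k) R) :=
      (shear R).commutes _
    rw [h']
    exact hmain.2
  · rintro ⟨σ, q⟩ hx
    dsimp only
    split_ifs with hq
    · have hne : ∃ i, (i, σ i, q i) ≠ diagVar l i := by
        by_contra! h
        refine (Finset.mem_erase.mp hx).1 (Prod.ext (Equiv.ext fun i => ?_) (funext fun i => ?_))
        · have := h i
          rw [diagVar_eq] at this
          exact congrArg (·.2.1) this
        · exact congrArg (·.2.2) (h i)
      have h' : shear R (C ((Equiv.Perm.sign σ : ℤ) : R)) =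
          (C ((Equiv.Perm.sign σ : ℤ) : R) : MvPolynomial (Vars (m + 1) k) R) :=
        (shear R).commutes _
      rw [map_mul, map_prod, h']
      refine weightLT_mono _ (sum_diagWeight_lt l σ q hq hne) ?_
      exact ((LeadsTo.prod Finset.univ fun i _ =>
        LeadsTo.refl (shear_X_mem R (i, σ i, q i))).C_mul _).1
    · rw [map_zero]
      exact zero_mem _

/-- The parameters: the coefficients of the determinant at the pivots, and linear forms at the
other variables. -/
def param (v : Vars (m + 1) k) : MvPolynomial (Vars (m + 1) k) R :=
  if h : IsPivot v then genCoeff R (m + 1) k (diagIndex v h.2) else X v - shift R v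

theorem param_diagVar (l : Fin k) : param R (diagVar (m := m) l 0) = genCoeff R (m + 1) k l := by
  rw [param, dif_pos (isPivot_diagVar l), diagIndex_diagVar]

/-- After `shear`, the non-pivot parameters are the variables themselves and the others lead with
powers of the pivots up to sign. Composing with the bijection `unshear` preserves flatness. -/
theorem flat_param :
    (aeval (param R) : MvPolynomial (Vars (m + 1) k) R →ₐ[R] _).toRingHom.Flat := by
  have h : (aeval fun v => shear R (param R v) : MvPolynomial (Vars (m + 1) k) R →ₐ[R] 
      MvPolynomial (Vars (m + 1) k) R).toRingHom.Flat := by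
    refine flat_aeval_of_leadsTo pivotWeight (fun v => if IsPivot v then m + 1 else 1)
      (fun v => by split_ifs <;> simp)
      (fun v => if IsPivot v then Units.map (Int.castRingHom R).toMonoidHom
        (Equiv.Perm.sign (diagPerm m (colPos v))) else 1) _ fun v => ?_
    by_cases hv : IsPivot v
    · simp only [if_pos hv]
      obtain ⟨l, rfl⟩ : ∃ l, v = diagVar l 0 := ⟨_, hv.eq⟩
      rw [param_diagVar, pivotWeight_diagVar, colPos_diagVar]
      simpa using shear_genCoeff R l
    · simp only [if_neg hv]
      rw [param, dif_neg hv, map_sub, shear_X, shear_shift, add_sub_cancel_right]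
      simpa using LeadsTo.refl (X_mem_weightLT (R := R) (Nat.lt_succ_self (pivotWeight v)))
  have hb : Function.Bijective (unshear R (m := m) (k := k)) :=
    Function.bijective_iff_has_inverse.mpr ⟨shear R, shear_unshear R, unshear_shear R⟩
  have h2 := h.comp (RingHom.Flat.of_bijective (f := (unshear R).toRingHom) hb)
  convert h2 using 1
  refine MvPolynomial.ringHom_ext (fun r => ?_) (fun v => ?_)
  · simp
  · simp [unshear_shear]

/-- The coefficients of the determinant, followed by the remaining parameters shifted by
constants, form a weakly regular sequence. -/
theorem isWeaklyRegular_param [IsDomain R] (c : Vars (m + 1) k → R) (l : List (Vars (m + 1) k))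
    (hl : l.Nodup) (hp : ∀ v ∈ l, ¬ IsPivot v) :
    RingTheory.Sequence.IsWeaklyRegular (MvPolynomial (Vars (m + 1) k) R)
      ((List.ofFn fun i : Fin k => genCoeff R (m + 1) k i) ++
        l.map fun v => X v - shift R v - C (c v)) := by
  classical
  have hinj : Function.Injective fun i : Fin k => diagVar (m := m) i 0 := fun i j h => by
    have := congrArg colPos h
    simpa [colPos_diagVar, Fin.val_inj] using this
  -- The constants are 0 at the pivots, so that the determinant coefficients occur unshifted.
  have h := isWeaklyRegular_map_of_flat (flat_param R (m := m) (k := k))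
    (isWeaklyRegular_X_sub_C (fun v => if IsPivot v then 0 else c v)
      ((List.ofFn fun i : Fin k => diagVar (m := m) i 0) ++ l) ?_)
  · refine (congrArg _ ?_).mp h
    rw [List.map_append, List.map_append, List.map_ofFn, List.map_ofFn, List.map_map]
    congr 1
    · congr 1
      ext1 i
      simp [isPivot_diagVar, param_diagVar]
    · refine List.map_congr_left fun v hv => ?_
      simp [hp v hv, param]
  · rw [List.nodup_append]
    refine ⟨List.nodup_ofFn.mpr hinj, hl, ?_⟩
    rintro a ha b hb rfl
    obtain ⟨i, rfl⟩ := (List.mem_ofFn' _ _).mp ha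
    exact hp _ hb (isPivot_diagVar i)

end Leading

/-! ### Coefficient ideals of power series and Schur complements. -/

section CoeffIdeal

variable {C D : Type*} [CommRing C] [CommRing D]

/-- The ideal generated by the first `k` coefficients of a power series. -/
def coeffIdeal (k : ℕ) (p : PowerSeries C) : Ideal C :=
  Ideal.span (Set.range fun l : Fin k => PowerSeries.coeff (l : ℕ) p)

theorem coeff_mem_coeffIdeal {k l : ℕ} (p : PowerSeries C) (hl : l < k) :
    PowerSeries.coeff l p ∈ coeffIdeal k p :=
  Ideal.subset_span ⟨⟨l, hl⟩, rfl⟩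

theorem map_coeffIdeal (k : ℕ) (p : PowerSeries C) (f : C →+* D) :
    (coeffIdeal k p).map f = coeffIdeal k (PowerSeries.map f p) := by
  rw [coeffIdeal, coeffIdeal, Ideal.map_span, ← Set.range_comp]
  congr 2

theorem coeffIdeal_mul_le (k : ℕ) (p q : PowerSeries C) :
    coeffIdeal k (p * q) ≤ coeffIdeal k q := by
  rw [coeffIdeal, Ideal.span_le]
  rintro _ ⟨l, rfl⟩
  simp only [PowerSeries.coeff_mul]
  refine Ideal.sum_mem _ fun x hx => Ideal.mul_mem_left _ _ (coeff_mem_coeffIdeal q ?_)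
  have := Finset.HasAntidiagonal.mem_antidiagonal.mp hx
  have := l.2
  omega

theorem coeffIdeal_unit_mul (k : ℕ) {p : PowerSeries C} (hp : IsUnit p) (q : PowerSeries C) :
    coeffIdeal k (p * q) = coeffIdeal k q := by
  refine le_antisymm (coeffIdeal_mul_le k p q) ?_
  obtain ⟨u, rfl⟩ := hp
  have := coeffIdeal_mul_le k (↑u⁻¹ : PowerSeries C) (u * q)
  rwa [← mul_assoc, Units.inv_mul, one_mul] at this

theorem coeffIdeal_congr {k : ℕ} {p q : PowerSeries C} (h : PowerSeries.X ^ k ∣ p - q) :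
    coeffIdeal k p = coeffIdeal k q := by
  rw [coeffIdeal, coeffIdeal]
  congr 2
  ext l
  rw [PowerSeries.X_pow_dvd_iff] at h
  simpa [sub_eq_zero] using h l l.2

theorem det_sub_det_dvd {n : ℕ} {P : Type*} [CommRing P] (a : P) (M N : Matrix (Fin n) (Fin n) P)
    (h : ∀ i j, a ∣ M i j - N i j) : a ∣ M.det - N.det := by
  have hMN : M.map (Ideal.Quotient.mk (Ideal.span {a})) =
      N.map (Ideal.Quotient.mk (Ideal.span {a})) := by
    ext i j
    rw [Matrix.map_apply, Matrix.map_apply, Ideal.Quotient.eq, Ideal.mem_span_singleton]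
    exact h i j
  rw [← Ideal.mem_span_singleton, ← Ideal.Quotient.eq, RingHom.map_det, RingHom.map_det]
  exact congrArg _ hMN

/-- The determinant in terms of the Schur complement of an invertible lower left entry. -/
theorem det_eq_of_schur {n : ℕ} {P : Type*} [CommRing P] (N : Matrix (Fin (n + 1)) (Fin (n + 1)) P)
    (Z : Matrix (Fin n) (Fin n) P) (u : P) (hu : u * N (Fin.last n) 0 = 1)
    (h : ∀ i j, N i.castSucc (Fin.succ j) =
      Z i j + N i.castSucc 0 * u * N (Fin.last n) (Fin.succ j)) :
    N.det = (-1) ^ n * N (Fin.last n) 0 * Z.det := by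
  let N' : Matrix (Fin (n + 1)) (Fin (n + 1)) P := Matrix.of fun i =>
    Fin.lastCases (motive := fun _ => Fin (n + 1) → P) (N (Fin.last n))
      (fun i => Fin.cons 0 (Z i)) i
  have hlast : ∀ j, N' (Fin.last n) j = N (Fin.last n) j := fun j => by simp [N']
  have hzero : ∀ i : Fin n, N' i.castSucc 0 = 0 := fun i => by simp [N']
  have hZ : ∀ (i : Fin n) (j : Fin n), N' i.castSucc j.succ = Z i j := fun i j => by simp [N']
  have h1 : N.det = N'.det := by
    refine Matrix.det_eq_of_forall_row_eq_smul_add_const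
      (fun i => Fin.lastCases (motive := fun _ => P) 0 (fun i => N i.castSucc 0 * u) i)
      (Fin.last n) (by simp) fun i j => ?_
    induction i using Fin.lastCases with
    | last => simp [hlast]
    | cast i =>
      rw [Fin.lastCases_castSucc, hlast]
      induction j using Fin.cases with
      | zero => rw [hzero, mul_assoc, hu]; ring
      | succ j => rw [hZ, h]
  have h2 : N'.submatrix (Fin.last n).succAbove Fin.succ = Z := by
    ext i j
    rw [Matrix.submatrix_apply, Fin.succAbove_last, hZ]
  rw [h1, Matrix.det_succ_column_zero, Finset.sum_eq_single (Fin.last n), h2, hlast]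
  · simp
  · intro i _ hi
    obtain ⟨i, rfl⟩ := Fin.exists_castSucc_eq.mpr hi
    rw [hzero]
    ring
  · simp

end CoeffIdeal

/-! ### Passage to power series, and the 1 × 1 case. -/

section Series

variable (R : Type*) [CommRing R] (m k : ℕ)

/-- The generic matrix with entries considered as power series. -/
def genSeries : Matrix (Fin m) (Fin m) (PowerSeries (MvPolynomial (Vars m k) R)) :=
  Matrix.of fun i j => PowerSeries.mk fun l => if h : l < k then X (i, j, ⟨l, h⟩) else 0

theorem genIdeal_eq_coeffIdeal : genIdeal R m k = coeffIdeal k (genSeries R m k).det := by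
  have h : (genSeries R m k) =
      Polynomial.coeToPowerSeries.ringHom.mapMatrix (genMatrix R m k) := by
    ext1 i j
    ext1 n
    simp only [genSeries, genMatrix, Matrix.of_apply, PowerSeries.coeff_mk,
      RingHom.mapMatrix_apply, Matrix.map_apply, Polynomial.coeToPowerSeries.ringHom_apply,
      Polynomial.coeff_coe, Polynomial.finsetSum_coeff, Polynomial.coeff_C_mul_X_pow]
    split_ifs with hn
    · rw [Finset.sum_eq_single ⟨n, hn⟩]
      · simp
      · intro l _ hl
        exact if_neg fun h => hl (Fin.ext h.symm)
      · simp
    · refine (Finset.sum_eq_zero fun l _ => if_neg fun h => ?_).symm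
      exact hn (h ▸ l.2)
  rw [h, ← RingHom.map_det, genIdeal, coeffIdeal]
  congr 2
  ext1 l
  simp [genCoeff]

end Series

/-- The determinant is the only entry, so the ideal is generated by all the variables and is the
kernel of `constantCoeff`. -/
theorem genIdeal_one_isPrime (R : Type*) [CommRing R] [IsDomain R] (k : ℕ) :
    (genIdeal R 1 k).IsPrime := by
  have h : genIdeal R 1 k = RingHom.ker (constantCoeff (R := R) (σ := Vars 1 k)) := by
    have h1 : genIdeal R 1 k = Ideal.span (X '' Set.univ) := by
      rw [genIdeal_eq_coeffIdeal, coeffIdeal, Set.image_univ]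
      congr 1
      ext p
      simp only [Set.mem_range, Matrix.det_fin_one, genSeries, Matrix.of_apply,
        PowerSeries.coeff_mk, Fin.is_lt, dite_true]
      constructor
      · rintro ⟨l, rfl⟩
        exact ⟨_, rfl⟩
      · rintro ⟨⟨i, j, l⟩, rfl⟩
        exact ⟨l, by rw [Subsingleton.elim i 0, Subsingleton.elim j 0]⟩
    ext p
    rw [h1, mem_ideal_span_X_image, RingHom.mem_ker, constantCoeff_eq]
    constructor
    · intro h
      by_contra h0
      obtain ⟨i, _, hi⟩ := h 0 (mem_support_iff.mpr h0)
      exact hi rfl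
    · intro h α hα
      by_contra! h0
      refine mem_support_iff.mp hα ?_
      rw [show α = 0 from Finsupp.ext fun i => h0 i (Set.mem_univ i), h]
  rw [h]
  exact RingHom.ker_isPrime _

/-! ### Reduction of the matrix size by inverting a corner entry. -/

section Step

variable {n k : ℕ}

/-- The variables in the last row or in the first column. -/
abbrev Border (n k : ℕ) : Type := {v : Vars (n + 1) k // v.1 = Fin.last n ∨ v.2.1 = 0}

/-- The variables outside of the last row and the first column are the variables of a generic
matrix of smaller size. -/
def splitVars (n k : ℕ) : Vars n k ⊕ Border n k → Vars (n + 1) k :=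
  Sum.elim (fun v => (v.1.castSucc, v.2.1.succ, v.2.2)) Subtype.val

theorem splitVars_bijective (n k : ℕ) : Function.Bijective (splitVars n k) := by
  constructor
  · rintro (⟨i, j, l⟩ | ⟨v, hv⟩) (⟨i', j', l'⟩ | ⟨v', hv'⟩) h
    · simpa [splitVars] using h
    · simp only [splitVars, Sum.elim_inl, Sum.elim_inr] at h
      subst h
      simp [Fin.castSucc_ne_last, Fin.succ_ne_zero] at hv'
    · simp only [splitVars, Sum.elim_inl, Sum.elim_inr] at h
      subst h
      simp [Fin.castSucc_ne_last, Fin.succ_ne_zero] at hv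
    · simpa [splitVars] using h
  · rintro ⟨i, j, l⟩
    by_cases h : i = Fin.last n ∨ j = 0
    · exact ⟨Sum.inr ⟨(i, j, l), h⟩, rfl⟩
    · rw [not_or] at h
      obtain ⟨i, rfl⟩ := Fin.exists_castSucc_eq.mpr h.1
      obtain ⟨j, rfl⟩ := Fin.exists_succ_eq.mpr h.2
      exact ⟨Sum.inl (i, j, l), rfl⟩

variable (R : Type*) [CommRing R]

/-- The polynomial ring of the generic matrix as a polynomial ring over the polynomial ring in the
border variables. -/
def splitEquiv (n k : ℕ) :
    MvPolynomial (Vars (n + 1) k) R ≃ₐ[R] MvPolynomial (Vars n k) (MvPolynomial (Border n k) R) :=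
  (renameEquiv R (Equiv.ofBijective _ (splitVars_bijective n k)).symm).trans
    (sumAlgEquiv R (Vars n k) (Border n k))

theorem splitEquiv_inl (v : Vars n k) :
    splitEquiv R n k (X (v.1.castSucc, v.2.1.succ, v.2.2)) = X v := by
  have h : (Equiv.ofBijective _ (splitVars_bijective n k)).symm
      (v.1.castSucc, v.2.1.succ, v.2.2) = Sum.inl v :=
    Equiv.ofBijective_symm_apply_apply _ (splitVars_bijective n k) (Sum.inl v)
  rw [splitEquiv, AlgEquiv.trans_apply, renameEquiv_apply, rename_X, h, sumAlgEquiv_X_inl]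

theorem splitEquiv_inr (v : Vars (n + 1) k) (hv : v.1 = Fin.last n ∨ v.2.1 = 0) :
    splitEquiv R n k (X v) = C (X ⟨v, hv⟩) := by
  have h : (Equiv.ofBijective _ (splitVars_bijective n k)).symm v = Sum.inr ⟨v, hv⟩ :=
    Equiv.ofBijective_symm_apply_apply _ (splitVars_bijective n k) (Sum.inr ⟨v, hv⟩)
  rw [splitEquiv, AlgEquiv.trans_apply, renameEquiv_apply, rename_X, h, sumAlgEquiv_X_inr]

/-- The translation of the variables by constants. -/
def translate {σ L : Type*} [CommRing L] (c : σ → L) : MvPolynomial σ L ≃ₐ[L] MvPolynomial σ L :=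
  AlgEquiv.ofAlgHom (aeval fun v => X v + C (c v)) (aeval fun v => X v - C (c v))
    (by ext1 v; simp) (by ext1 v; simp)

theorem translate_X {σ L : Type*} [CommRing L] (c : σ → L) (v : σ) :
    translate c (X v) = X v + C (c v) := aeval_X _ _

/-- The entry `X(0)` in the lower left corner. -/
def corner (hk : 0 < k) : MvPolynomial (Border n k) R :=
  X ⟨(Fin.last n, 0, ⟨0, hk⟩), Or.inl rfl⟩

attribute [local instance] algebraMvPolynomial in
/-- After inverting the lower left entry of `X(0)`, the ideal of the generic matrix becomes the
ideal of a generic matrix of smaller size. -/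
theorem exists_map_genIdeal_eq (hk : 0 < k) (L : Type*) [CommRing L]
    [Algebra (MvPolynomial (Border n k) R) L] [IsLocalization.Away (corner R (n := n) hk) L] :
    ∃ ψ : MvPolynomial (Vars (n + 1) k) R →+* MvPolynomial (Vars n k) L,
      (genIdeal R (n + 1) k).map ψ = genIdeal L n k ∧
      ∀ (I : Ideal (MvPolynomial (Vars (n + 1) k) R)) (p : MvPolynomial (Vars (n + 1) k) R),
        ψ p ∈ I.map ψ → ∃ N : ℕ, X (Fin.last n, 0, ⟨0, hk⟩) ^ N * p ∈ I := by
  -- Only border coefficients below `k` are prescribed; the value 0 elsewhere is immaterial modulo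
  -- `t^k`.
  obtain ⟨b, hb⟩ : ∃ b : Fin (n + 1) → Fin (n + 1) → PowerSeries L,
      ∀ i j l (h : i = Fin.last n ∨ j = 0) (hl : l < k), PowerSeries.coeff l (b i j) =
        algebraMap (MvPolynomial (Border n k) R) L (X ⟨(i, j, ⟨l, hl⟩), h⟩) :=
    ⟨fun i j => PowerSeries.mk fun l => if h : (i = Fin.last n ∨ j = 0) ∧ l < k then
      algebraMap (MvPolynomial (Border n k) R) L (X ⟨(i, j, ⟨l, h.2⟩), h.1⟩) else 0,
      fun i j l h hl => by rw [PowerSeries.coeff_mk, dif_pos ⟨h, hl⟩]⟩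
  have hunit : IsUnit (b (Fin.last n) 0) := by
    rw [PowerSeries.isUnit_iff_constantCoeff, ← PowerSeries.coeff_zero_eq_constantCoeff_apply,
      hb _ _ _ (Or.inl rfl) hk]
    exact IsLocalization.Away.algebraMap_isUnit (corner R (n := n) hk)
  obtain ⟨u, hu⟩ := hunit.exists_left_inv
  -- The correction term of the Schur complement: translating by it makes that complement generic
  -- modulo `t^k`.
  obtain ⟨c, hc⟩ : ∃ c : Vars n k → L, ∀ v, c v =
    PowerSeries.coeff (v.2.2 : ℕ) (b v.1.castSucc 0 * u * b (Fin.last n) v.2.1.succ) :=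
    ⟨_, fun _ => rfl⟩
  let ψ₁ : MvPolynomial (Vars (n + 1) k) R →+* MvPolynomial (Vars n k) L :=
    (algebraMap (MvPolynomial (Vars n k) (MvPolynomial (Border n k) R))
      (MvPolynomial (Vars n k) L)).comp (splitEquiv R n k : _ →+* _)
  let ψ₂ : MvPolynomial (Vars (n + 1) k) R →+* MvPolynomial (Vars n k) L :=
    (translate c : _ →+* MvPolynomial (Vars n k) L).comp ψ₁
  obtain ⟨ψ, hψ⟩ : ∃ ψ, ψ = ψ₂ := ⟨_, rfl⟩
  have hinl : ∀ v : Vars n k,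
      ψ (X (v.1.castSucc, v.2.1.succ, v.2.2)) = X v + C (c v) := fun v => by
    simp [hψ, ψ₂, ψ₁, splitEquiv_inl, translate_X]
  have hinr : ∀ (v : Vars (n + 1) k) (hv : v.1 = Fin.last n ∨ v.2.1 = 0),
      ψ (X v) = C (algebraMap (MvPolynomial (Border n k) R) L (X ⟨v, hv⟩)) := fun v hv => by
    simp only [hψ, ψ₂, ψ₁, RingHom.comp_apply, RingHom.coe_coe, splitEquiv_inr R v hv,
      algebraMap_def, map_C]
    exact (translate c).commutes (algebraMap (MvPolynomial (Border n k) R) L (X ⟨v, hv⟩))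
  refine ⟨ψ, ?_, ?_⟩
  · rw [genIdeal_eq_coeffIdeal, genIdeal_eq_coeffIdeal, map_coeffIdeal, RingHom.map_det]
    -- `N` has Schur complement exactly `genSeries`. Its correction term is not truncated, so it
    -- agrees with the image of the generic matrix only modulo `t^k`, which suffices for the
    -- coefficient ideal.
    obtain ⟨N, hN1, hN2, hN3⟩ : ∃ N : Matrix (Fin (n + 1)) (Fin (n + 1))
        (PowerSeries (MvPolynomial (Vars n k) L)),
        (∀ j, N (Fin.last n) j = PowerSeries.map C (b (Fin.last n) j)) ∧
        (∀ i : Fin n, N i.castSucc 0 = PowerSeries.map C (b i.castSucc 0)) ∧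
        ∀ i j : Fin n, N i.castSucc j.succ = genSeries L n k i j +
          PowerSeries.map C (b i.castSucc 0 * u * b (Fin.last n) j.succ) :=
      ⟨Matrix.of fun i => Fin.lastCases
        (motive := fun _ => Fin (n + 1) → PowerSeries (MvPolynomial (Vars n k) L))
        (fun j => PowerSeries.map C (b (Fin.last n) j))
        (fun i => Fin.cons (PowerSeries.map C (b i.castSucc 0)) fun j => genSeries L n k i j +
          PowerSeries.map C (b i.castSucc 0 * u * b (Fin.last n) j.succ)) i,
        fun j => by simp, fun i => by simp, fun i j => by simp⟩
    have hschur := det_eq_of_schur N (genSeries L n k) (PowerSeries.map C u)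
      (by rw [hN1, ← map_mul, hu, map_one])
      (fun i j => by rw [hN3, hN2, hN1, map_mul, map_mul])
    have hunit' : IsUnit ((-1) ^ n * N (Fin.last n) 0) := by
      rw [hN1]
      exact (isUnit_one.neg.pow n).mul (hunit.map _)
    rw [← coeffIdeal_unit_mul k hunit' (genSeries L n k).det, ← hschur]
    refine coeffIdeal_congr (det_sub_det_dvd _ _ _ fun i j => ?_)
    rw [PowerSeries.X_pow_dvd_iff]
    intro l hl
    have hborder : ∀ i j, (i = Fin.last n ∨ j = 0) →
        PowerSeries.coeff l (PowerSeries.map ψ (genSeries R (n + 1) k i j)) =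
          PowerSeries.coeff l (PowerSeries.map C (b i j)) := by
      intro i j hij
      rw [PowerSeries.coeff_map, PowerSeries.coeff_map, hb i j l hij hl, genSeries,
        Matrix.of_apply, PowerSeries.coeff_mk, dif_pos hl]
      exact hinr (i, j, ⟨l, hl⟩) hij
    rw [map_sub, sub_eq_zero, RingHom.mapMatrix_apply, Matrix.map_apply]
    induction i using Fin.lastCases with
    | last => rw [hborder _ _ (Or.inl rfl), hN1]
    | cast i =>
      induction j using Fin.cases with
      | zero => rw [hborder _ _ (Or.inr rfl), hN2]
      | succ j =>
        rw [hN3, map_add, PowerSeries.coeff_map, PowerSeries.coeff_map, genSeries,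
          Matrix.of_apply, PowerSeries.coeff_mk, dif_pos hl, genSeries,
          Matrix.of_apply, PowerSeries.coeff_mk, dif_pos hl,
          hinl (i, j, ⟨l, hl⟩), hc]
  · intro I p hp
    -- Undoing the translation leaves an isomorphism followed by a localization, where membership in
    -- an extended ideal costs a power of the corner.
    have h1 : ψ₁ p ∈ I.map ψ₁ := by
      have := Ideal.comap_map_of_bijective (translate c : _ →+* MvPolynomial (Vars n k) L)
        (translate c).bijective (I := I.map ψ₁)
      rw [← this, Ideal.mem_comap, Ideal.map_map]
      rw [hψ] at hp
      exact hp
    rw [← Ideal.map_map, RingHom.comp_apply, IsLocalization.algebraMap_mem_map_algebraMap_iff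
      ((Submonoid.powers (corner R (n := n) hk)).map (C (σ := Vars n k)))] at h1
    obtain ⟨_, ⟨_, ⟨N, rfl⟩, rfl⟩, h2⟩ := h1
    refine ⟨N, ?_⟩
    rw [← Ideal.comap_map_of_bijective
      (splitEquiv R n k : _ →+* MvPolynomial (Vars n k) (MvPolynomial (Border n k) R)) (splitEquiv R n k).bijective
      (I := I), Ideal.mem_comap, map_mul, map_pow]
    convert h2 using 2
    rw [map_pow]
    congr 1
    exact splitEquiv_inr R _ (Or.inl rfl)

/-- The corner has position 0 in row `n > 0`, below diagonal 0. Its parameter is thus the variable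
itself, which may follow the determinant coefficients in the regular sequence. -/
theorem mem_genIdeal_of_X_mul_mem [IsDomain R] (hn : 0 < n) (hk : 0 < k)
    {p : MvPolynomial (Vars (n + 1) k) R}
    (hp : X (Fin.last n, 0, ⟨0, hk⟩) * p ∈ genIdeal R (n + 1) k) : p ∈ genIdeal R (n + 1) k := by
  have hdiag : ¬ OnDiag ((Fin.last n, 0, ⟨0, hk⟩) : Vars (n + 1) k) := fun h => by
    have := h.1
    simp [colPos] at this
    omega
  have h := isWeaklyRegular_param R (m := n) (k := k) 0 [(Fin.last n, 0, ⟨0, hk⟩)]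
    (List.nodup_singleton _) (by simpa using fun h => hdiag h.2)
  rw [RingTheory.Sequence.isWeaklyRegular_append_iff] at h
  have h2 := h.2
  rw [List.map_singleton, RingTheory.Sequence.isWeaklyRegular_singleton_iff,
    isSMulRegular_quotient_iff_mem_of_smul_mem] at h2
  rw [Ideal.smul_eq_mul, Ideal.mul_top, ofList_genCoeff] at h2
  refine h2 p ?_
  rw [shift, dif_neg fun h => hdiag h.2]
  simpa using hp

end Step

/-! ### Primality. -/

/-- The coefficient ring must vary: the inductive step replaces `R` by a localization of the
polynomial ring in the border variables. -/
theorem genIdeal_isPrime (n k : ℕ) (hk : 0 < k) (R : Type*) [CommRing R] [IsDomain R] :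
    (genIdeal R (n + 1) k).IsPrime := by
  induction n generalizing R with
  | zero => exact genIdeal_one_isPrime R k
  | succ n ih =>
    let s := corner R (n := n + 1) hk
    have : IsDomain (Localization.Away s) := IsLocalization.isDomain_localization
      (powers_le_nonZeroDivisors_of_noZeroDivisors (X_ne_zero _))
    obtain ⟨ψ, h1, h2⟩ := exists_map_genIdeal_eq (n := n + 1) R hk (Localization.Away s)
    -- Powers of the corner cancel modulo the ideal, so nothing is lost by localizing and
    -- contracting.
    have h3 : genIdeal R (n + 1 + 1) k = (genIdeal (Localization.Away s) (n + 1) k).comap ψ := by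
      rw [← h1]
      refine le_antisymm Ideal.le_comap_map fun p hp => ?_
      obtain ⟨N, hN⟩ := h2 _ p hp
      induction N with
      | zero => simpa using hN
      | succ N ihN =>
        rw [pow_succ', mul_assoc] at hN
        exact ihN (mem_genIdeal_of_X_mul_mem R n.succ_pos hk hN)
    rw [h3]
    have := ih (Localization.Away s)
    exact Ideal.comap_isPrime ψ _

open RingTheory.Sequence

/-! ### Regular sequences, dimension and height. -/

section Depth

/-- A weakly regular sequence lowers the Krull dimension by at least its length. -/
theorem ringKrullDim_quotient_ofList_add_length_le {R : Type*} [CommRing R] (rs : List R)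
    (h : IsWeaklyRegular R rs) :
    ringKrullDim (R ⧸ Ideal.ofList rs) + rs.length ≤ ringKrullDim R := by
  induction rs using List.reverseRecOn with
  | nil => simpa using ringKrullDim_quotient_le (Ideal.ofList ([] : List R))
  | append_singleton rs r ih =>
    rw [isWeaklyRegular_append_iff, isWeaklyRegular_singleton_iff,
      isSMulRegular_quotient_iff_mem_of_smul_mem, Ideal.smul_eq_mul, Ideal.mul_top] at h
    have hle : Ideal.ofList rs ≤ Ideal.ofList (rs ++ [r]) := by
      rw [Ideal.ofList_append]
      exact le_sup_left
    have hr : Ideal.Quotient.mk (Ideal.ofList rs) r ∈ nonZeroDivisors (R ⧸ Ideal.ofList rs) := by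
      rw [mem_nonZeroDivisors_iff_left]
      intro x hx
      obtain ⟨x, rfl⟩ := Ideal.Quotient.mk_surjective x
      rw [← map_mul, Ideal.Quotient.eq_zero_iff_mem] at hx
      exact Ideal.Quotient.eq_zero_iff_mem.mpr (h.2 x hx)
    have h1 := ringKrullDim_succ_le_of_surjective (Ideal.Quotient.factor hle)
      (Ideal.Quotient.factor_surjective hle) hr (by
        rw [Ideal.Quotient.factor_mk, Ideal.Quotient.eq_zero_iff_mem]
        exact Ideal.subset_span (by simp))
    calc ringKrullDim (R ⧸ Ideal.ofList (rs ++ [r])) + ((rs ++ [r]).length : ℕ)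
        = ringKrullDim (R ⧸ Ideal.ofList (rs ++ [r])) + 1 + rs.length := by
          rw [List.length_append, List.length_singleton, Nat.cast_add, Nat.cast_one, add_assoc,
            add_comm (1 : WithBot ℕ∞)]
      _ ≤ ringKrullDim (R ⧸ Ideal.ofList rs) + rs.length := by gcongr
      _ ≤ ringKrullDim R := ih h.1

/-- In the local ring at `P` the quotient by the sequence is nontrivial, so its dimension is
nonnegative, and the dimension of the local ring is the height. -/
theorem length_le_height {R : Type*} [CommRing R] (P : Ideal R) [P.IsPrime] (rs : List R)
    (h : IsWeaklyRegular R rs) (hP : ∀ r ∈ rs, r ∈ P) : (rs.length : ℕ∞) ≤ P.height := by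
  have h1 := h.isRegular_of_isLocalization_of_mem (S := Localization.AtPrime P) P hP
  have h2 := ringKrullDim_quotient_ofList_add_length_le _ h1.toIsWeaklyRegular
  rw [IsLocalization.AtPrime.ringKrullDim_eq_height P (Localization.AtPrime P), List.length_map] at h2
  have : Nontrivial (Localization.AtPrime P ⧸
      Ideal.ofList (rs.map (algebraMap R (Localization.AtPrime P)))) := by
    rw [Ideal.Quotient.nontrivial_iff]
    have := h1.top_ne_smul
    rw [Ideal.smul_eq_mul, Ideal.mul_top] at this
    exact this.symm
  have h3 : (rs.length : WithBot ℕ∞) ≤ P.height := by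
    refine le_trans ?_ h2
    exact le_add_of_nonneg_left ringKrullDim_nonneg_of_nontrivial
  exact_mod_cast h3

theorem idealDepth_le_height {R : Type*} [CommRing R] (P : Ideal R) [P.IsPrime] :
    idealDepth P ≤ P.height :=
  iSup_le fun f => length_le_height P f.1 f.2.1.toIsWeaklyRegular f.2.2

end Depth

/-! ### Height, complete intersection and Cohen-Macaulayness over a field. -/

section Field

variable (F : Type*) [Field F] (n k : ℕ)

theorem isRegular_genCoeff (hk : 0 < k) :
    IsRegular (MvPolynomial (Vars (n + 1) k) F)
      (List.ofFn fun i : Fin k => genCoeff F (n + 1) k i) := by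
  refine ⟨?_, ?_⟩
  · simpa using isWeaklyRegular_param F (m := n) (k := k) 0 [] List.nodup_nil (by simp)
  · rw [Ideal.smul_eq_mul, Ideal.mul_top, ofList_genCoeff]
    exact (genIdeal_isPrime n k hk F).ne_top.symm

theorem height_genIdeal (hk : 0 < k) : (genIdeal F (n + 1) k).height = k := by
  classical
  have := genIdeal_isPrime n k hk F
  refine le_antisymm ?_ ?_
  · have h := Ideal.height_le_card_of_mem_minimalPrimes_span_finset (p := genIdeal F (n + 1) k)
      (s := Finset.univ.image fun l : Fin k => genCoeff F (n + 1) k l) (by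
        rw [Finset.coe_image, Finset.coe_univ, Set.image_univ]
        change _ ∈ (genIdeal F (n + 1) k).minimalPrimes
        rw [Ideal.minimalPrimes_eq_subsingleton_self]
        rfl)
    refine h.trans ?_
    exact_mod_cast Finset.card_image_le.trans (by simp)
  · have h := length_le_height (genIdeal F (n + 1) k) _ (isRegular_genCoeff F n k hk).1
      fun r hr => by
        rw [← ofList_genCoeff]
        exact Ideal.subset_span hr
    simpa using h

theorem isCompleteIntersection_quotient (hk : 0 < k) :
    IsCompleteIntersection F (MvPolynomial (Vars (n + 1) k) F ⧸ genIdeal F (n + 1) k) := by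
  let e := renameEquiv F (Fintype.equivFin (Vars (n + 1) k))
  refine ⟨Fintype.card (Vars (n + 1) k),
    (List.ofFn fun i : Fin k => genCoeff F (n + 1) k i).map e, ?_, ?_⟩
  · refine (AddEquiv.isRegular_congr (e := (e : _ ≃+ _)) ?_).mp (isRegular_genCoeff F n k hk)
    rw [List.forall₂_map_right_iff, List.forall₂_same]
    intro r _ x
    exact map_mul e r x
  · have h : Ideal.ofList ((List.ofFn fun i : Fin k => genCoeff F (n + 1) k i).map e) =
        (genIdeal F (n + 1) k).map (e : MvPolynomial (Vars (n + 1) k) F →+*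
          MvPolynomial (Fin (Fintype.card (Vars (n + 1) k))) F) := by
      rw [← ofList_genCoeff, Ideal.map_ofList]
      rfl
    exact ⟨Ideal.quotientEquivAlg _ _ e h⟩

/-- Each pivot is determined by its diagonal, so there are at most `k` of them. -/
theorem card_vars_le :
    Fintype.card (Vars (n + 1) k) ≤
      (Finset.univ.filter fun v : Vars (n + 1) k => ¬ IsPivot v).toList.length + k := by
  classical
  rw [Finset.length_toList, ← Finset.card_univ,
    ← Finset.card_filter_add_card_filter_not (s := Finset.univ)
      (p := fun v : Vars (n + 1) k => IsPivot v), add_comm]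
  refine Nat.add_le_add_left ?_ _
  calc (Finset.univ.filter fun v : Vars (n + 1) k => IsPivot v).card
      ≤ (Finset.univ.image fun l : Fin k => diagVar (m := n) l 0).card := by
        refine Finset.card_le_card fun v hv => ?_
        rw [Finset.mem_filter] at hv
        exact Finset.mem_image.mpr ⟨_, Finset.mem_univ _, hv.2.eq.symm⟩
    _ ≤ k := Finset.card_image_le.trans (by simp)

theorem isCohenMacaulay_quotient [IsAlgClosed F] :
    IsCohenMacaulay (MvPolynomial (Vars (n + 1) k) F ⧸ genIdeal F (n + 1) k) := by
  refine ⟨inferInstance, fun P hP => le_antisymm (idealDepth_le_height P) ?_⟩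
  have hM := Ideal.comap_isMaximal_of_surjective (Ideal.Quotient.mk (genIdeal F (n + 1) k))
    Ideal.Quotient.mk_surjective (K := P)
  -- By the Nullstellensatz the maximal ideal is a point `a`; each linear form minus its value at
  -- `a` lies in it.
  obtain ⟨a, ha⟩ := isMaximal_iff_eq_vanishingIdeal_singleton.mp hM
  set l := (Finset.univ.filter fun v : Vars (n + 1) k => ¬ IsPivot v).toList with hl
  let y : Vars (n + 1) k → MvPolynomial (Vars (n + 1) k) F := fun v =>
    X v - shift F v - C (aeval a (X v - shift F v))
  have hreg := isWeaklyRegular_param F (m := n) (k := k) (fun v => aeval a (X v - shift F v)) l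
    (Finset.nodup_toList _) (fun v hv => by simpa [hl] using hv)
  have h1 := (isWeaklyRegular_append_iff _ _ _).mp hreg
  rw [ofList_genCoeff, Ideal.smul_eq_mul, Ideal.mul_top] at h1
  have h2 := (isWeaklyRegular_map_algebraMap_iff
    (S := MvPolynomial (Vars (n + 1) k) F ⧸ genIdeal F (n + 1) k) _ _).mpr h1.2
  have hmem : ∀ r ∈ (l.map y).map (algebraMap _
      (MvPolynomial (Vars (n + 1) k) F ⧸ genIdeal F (n + 1) k)), r ∈ P := by
    intro r hr
    obtain ⟨_, hp, rfl⟩ := List.mem_map.mp hr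
    obtain ⟨v, _, rfl⟩ := List.mem_map.mp hp
    change y v ∈ P.comap (Ideal.Quotient.mk (genIdeal F (n + 1) k))
    rw [ha, mem_vanishingIdeal_singleton_iff]
    simp [y]
  have h3 : IsRegular (MvPolynomial (Vars (n + 1) k) F ⧸ genIdeal F (n + 1) k)
      ((l.map y).map (algebraMap _ (MvPolynomial (Vars (n + 1) k) F ⧸ genIdeal F (n + 1) k))) := by
    refine ⟨h2, fun h => hP.ne_top ?_⟩
    rw [Ideal.smul_eq_mul, Ideal.mul_top] at h
    rw [eq_top_iff, h]
    exact Ideal.span_le.mpr hmem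
  -- The determinant coefficients lower the dimension by at least `k`, leaving at most the number of
  -- non-pivots.
  have h4 : P.height ≤ l.length := by
    have hd := ringKrullDim_quotient_ofList_add_length_le _ h1.1
    rw [ofList_genCoeff, MvPolynomial.ringKrullDim_of_isNoetherianRing,
      ringKrullDim_eq_zero_of_field, zero_add, List.length_ofFn, Nat.card_eq_fintype_card] at hd
    have h5 := Ideal.height_le_ringKrullDim_of_ne_top hP.ne_top
    have h6 : (P.height : WithBot ℕ∞) + k ≤ ((l.length + k : ℕ) : WithBot ℕ∞) :=
      (add_le_add_left h5 _).trans (hd.trans (by exact_mod_cast card_vars_le n k))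
    have h7 : P.height + k ≤ l.length + k := by exact_mod_cast h6
    exact (ENat.add_le_add_iff_right (ENat.natCast_ne_top k)).mp h7
  refine h4.trans ?_
  refine le_trans (le_of_eq ?_) (le_iSup (fun f : {f : List (MvPolynomial (Vars (n + 1) k) F ⧸
    genIdeal F (n + 1) k) // IsRegular _ f ∧ ∀ a ∈ f, a ∈ P} => (f.1.length : ℕ∞)) ⟨_, h3, hmem⟩)
  simp

end Field

end TruncDet

end

theorem theorem3p4 {F : Type*} [Field F] [IsAlgClosed F] (m k : ℕ) (hm : 1 ≤ m) (hk : 1 ≤ k) :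
    (TruncDet.detIdeal F m k).IsPrime ∧
    (TruncDet.detIdeal F m k).height = k ∧
    MvPolynomial.vanishingIdeal F (TruncDet.detVariety F m k) = TruncDet.detIdeal F m k ∧
    TruncDet.IsCompleteIntersection F (TruncDet.coordRing F m k) ∧
    TruncDet.IsCohenMacaulay (TruncDet.coordRing F m k) := by
  obtain ⟨n, rfl⟩ : ∃ n, m = n + 1 := ⟨m - 1, by omega⟩
  have hI : TruncDet.detIdeal F (n + 1) k = TruncDet.genIdeal F (n + 1) k := rfl
  have hprime := TruncDet.genIdeal_isPrime n k hk F
  have hv : MvPolynomial.vanishingIdeal F (TruncDet.detVariety F (n + 1) k) =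
      TruncDet.genIdeal F (n + 1) k :=
    MvPolynomial.IsPrime.vanishingIdeal_zeroLocus (K := F) _ (h := hprime)
  unfold TruncDet.coordRing
  rw [hv, hI]
  exact ⟨hprime, TruncDet.height_genIdeal F n k hk, rfl,
    TruncDet.isCompleteIntersection_quotient F n k hk, TruncDet.isCohenMacaulay_quotient F n k⟩
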